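/- Consider the discrete-time linear system $$x_{k+1}=A_kx_k+B_ku_k+w_k,\qquad y_k=C_kx_k+v_k,\qquad k\in\mathbb N,$$ with $x_k,w_k\in\mathbb R^n$, $u_k\in\mathbb R^m$, $y_k,v_k\in\mathbb R^p$, and deterministic real matrices $A_k,B_k,C_k$. Suppose that $x_0$ is a (possibly degenerate) Gaussian random vector, that the $w_k$ and the $v_k$ are zero-mean (possibly degenerate) Gaussian random vectors, and that $x_0,w_0,w_1,\dots,v_0,v_1,\dots$ are mutually independent. Let the inputs be given by causal output feedback $u_k=\pi_k(y_0,\dots,y_k)$ with measurable maps $\pi_k$ (which includes deterministic open-loop inputs). Put $Q_k=\mathbb E[w_kw_k^\top]$, $R_k=\mathbb E[v_kv_k^\top]$, and let the Kalman one-step predictor $\hat x_k$ and the matrices $P_k$ be given by $\hat x_0=\mathbb E[x_0]$, $P_0=\mathbb E[(x_0-\hat x_0)(x_0-\hat x_0)^\top]$, $$\hat x_{k+1}=A_k\hat x_k+B_ku_k+K_k(y_k-C_k\hat x_k),\qquad K_k=A_kP_kC_k^\top(C_kP_kC_k^\top+R_k)^{-1},$$ $$P_{k+1}=A_kP_kA_k^\top+Q_k-A_kP_kC_k^\top(C_kP_kC_k^\top+R_k)^{-1}C_kP_kA_k^\top,$$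 where the matrices $C_kP_kC_k^\top+R_k$ are assumed to be invertible. Then, for all $k\in\mathbb N$, $\hat x_k=\mathbb E[x_k\mid y_0,\dots,y_{k-1}]$ almost surely whenever $x_k$ is integrable, the error $x_k-\hat x_k$ is square integrable, and, almost surely, $$\mathbb E[x_k-\hat x_k\mid \hat x_k]=0,\qquad \operatorname{cov}[x_k-\hat x_k\mid \hat x_k]=P_k,$$ where $\operatorname{cov}[X\mid Z]=\mathbb E\big[(X-\mathbb E[X\mid Z])(X-\mathbb E[X\mid Z])^\top\mid Z\big]$. -/

import Mathlib

open MeasureTheory ProbabilityTheory Matrix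
open scoped Matrix

namespace KalmanFilter

variable {Ω : Type*} {n m p : ℕ}

/-- The second moment matrix `𝔼[X Xᵀ]` of a random vector `X`. -/
noncomputable def secondMoment [MeasurableSpace Ω] {d : ℕ} (μ : Measure Ω)
    (X : Ω → Fin d → ℝ) : Matrix (Fin d) (Fin d) ℝ :=
  Matrix.of fun i j => ∫ ω, X ω i * X ω j ∂μ

/-- The conditional covariance matrix
`cov[X | 𝓖] = 𝔼[(X - 𝔼[X | 𝓖]) (X - 𝔼[X | 𝓖])ᵀ | 𝓖]` of a random vector `X` given a
sub-sigma-algebra `𝓖`, as a random matrix (determined up to a null set). -/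
noncomputable def condCov [MeasurableSpace Ω] {d : ℕ} (μ : Measure Ω) (𝓖 : MeasurableSpace Ω)
    (X : Ω → Fin d → ℝ) (ω : Ω) : Matrix (Fin d) (Fin d) ℝ :=
  Matrix.of fun i j =>
    (μ[fun ω' => (X ω' i - (μ[X | 𝓖]) ω' i) * (X ω' j - (μ[X | 𝓖]) ω' j) | 𝓖]) ω

/-- The sigma-algebras generated by the primitive random vectors of the system: the initial state
`x₀`, the disturbances `w k` and the measurement noises `v k`. -/
@[reducible] def sourceSigma (x₀ : Ω → Fin n → ℝ) (w : ℕ → Ω → Fin n → ℝ) (v : ℕ → Ω → Fin p → ℝ) :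
    Option (ℕ ⊕ ℕ) → MeasurableSpace Ω
  | none => MeasurableSpace.comap x₀ inferInstance
  | some (Sum.inl k) => MeasurableSpace.comap (w k) inferInstance
  | some (Sum.inr k) => MeasurableSpace.comap (v k) inferInstance

/-- The sigma-algebra generated by the measurements `y 0, …, y (k - 1)`
(trivial for `k = 0`). -/
@[reducible] def history (y : ℕ → Ω → Fin p → ℝ) (k : ℕ) : MeasurableSpace Ω :=
  ⨆ j : Fin k, MeasurableSpace.comap (y j) inferInstance

/-- The Riccati recursion for the prediction error covariance. -/
noncomputable def riccati (A : ℕ → Matrix (Fin n) (Fin n) ℝ) (C : ℕ → Matrix (Fin p) (Fin n) ℝ)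
    (Q : ℕ → Matrix (Fin n) (Fin n) ℝ) (R : ℕ → Matrix (Fin p) (Fin p) ℝ)
    (P₀ : Matrix (Fin n) (Fin n) ℝ) : ℕ → Matrix (Fin n) (Fin n) ℝ
  | 0 => P₀
  | k + 1 =>
    A k * riccati A C Q R P₀ k * (A k)ᵀ + Q k
      - A k * riccati A C Q R P₀ k * (C k)ᵀ
        * (C k * riccati A C Q R P₀ k * (C k)ᵀ + R k)⁻¹
        * C k * riccati A C Q R P₀ k * (A k)ᵀ

/-- The prediction error covariance matrices `P k`: the Riccati recursion with
`Q k = 𝔼[w k (w k)ᵀ]`, `R k = 𝔼[v k (v k)ᵀ]` and `P 0 = 𝔼[(x₀ - 𝔼 x₀) (x₀ - 𝔼 x₀)ᵀ]`. -/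
noncomputable def errorCov [MeasurableSpace Ω] (μ : Measure Ω)
    (A : ℕ → Matrix (Fin n) (Fin n) ℝ) (C : ℕ → Matrix (Fin p) (Fin n) ℝ)
    (x₀ : Ω → Fin n → ℝ) (w : ℕ → Ω → Fin n → ℝ) (v : ℕ → Ω → Fin p → ℝ) :
    ℕ → Matrix (Fin n) (Fin n) ℝ :=
  riccati A C (fun k => secondMoment μ (w k)) (fun k => secondMoment μ (v k))
    (secondMoment μ fun ω => x₀ ω - ∫ ω', x₀ ω' ∂μ)

/-- The matrices `C k P k (C k)ᵀ + R k` that the Kalman filter inverts. -/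
noncomputable def innovationCov [MeasurableSpace Ω] (μ : Measure Ω)
    (A : ℕ → Matrix (Fin n) (Fin n) ℝ) (C : ℕ → Matrix (Fin p) (Fin n) ℝ)
    (x₀ : Ω → Fin n → ℝ) (w : ℕ → Ω → Fin n → ℝ) (v : ℕ → Ω → Fin p → ℝ) (k : ℕ) :
    Matrix (Fin p) (Fin p) ℝ :=
  C k * errorCov μ A C x₀ w v k * (C k)ᵀ + secondMoment μ (v k)

/-- The Kalman gain `K k = A k P k (C k)ᵀ (C k P k (C k)ᵀ + R k)⁻¹`. -/
noncomputable def gain [MeasurableSpace Ω] (μ : Measure Ω)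
    (A : ℕ → Matrix (Fin n) (Fin n) ℝ) (C : ℕ → Matrix (Fin p) (Fin n) ℝ)
    (x₀ : Ω → Fin n → ℝ) (w : ℕ → Ω → Fin n → ℝ) (v : ℕ → Ω → Fin p → ℝ) (k : ℕ) :
    Matrix (Fin n) (Fin p) ℝ :=
  A k * errorCov μ A C x₀ w v k * (C k)ᵀ * (innovationCov μ A C x₀ w v k)⁻¹

/-- The Kalman one-step predictor `x̂ k`, started at `x̂ 0 = 𝔼[x₀]`. -/
noncomputable def estimate [MeasurableSpace Ω] (μ : Measure Ω)
    (A : ℕ → Matrix (Fin n) (Fin n) ℝ) (B : ℕ → Matrix (Fin n) (Fin m) ℝ)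
    (C : ℕ → Matrix (Fin p) (Fin n) ℝ) (x₀ : Ω → Fin n → ℝ)
    (w : ℕ → Ω → Fin n → ℝ) (v : ℕ → Ω → Fin p → ℝ)
    (u : ℕ → Ω → Fin m → ℝ) (y : ℕ → Ω → Fin p → ℝ) : ℕ → Ω → Fin n → ℝ
  | 0 => fun _ => ∫ ω', x₀ ω' ∂μ
  | k + 1 => fun ω =>
    A k *ᵥ estimate μ A B C x₀ w v u y k ω + B k *ᵥ u k ω
      + gain μ A C x₀ w v k *ᵥ (y k ω - C k *ᵥ estimate μ A B C x₀ w v u y k ω)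

end KalmanFilter

/-! With feedback by arbitrary measurable maps the state need be neither Gaussian nor integrable.
The error `e k = x k - xhat k` is unaffected: the input cancels, and `e (k + 1)` and the innovation
`C k e k + v k` are one linear image of `(e k, w k, v k)`.

The invariant, proved by induction in `error_properties`, is that `e k` is centered Gaussian with
covariance `P k` and independent of the measurements before time `k`. In the step, `(e k, w k, v k)`
is Gaussian and independent of the old history; the gain makes `e (k + 1)` uncorrelated with the
innovation, hence independent of it (`error_step`). By `indep_sup_right_of_indep_sup_left`, `e (k +
1)` is independent of old history and innovation together, which determine `y k`.

The estimate is a function of that history, so conditioning on either leaves the moments of the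
error unchanged. -/

namespace KalmanFilter

/-! ### Regrouping independent sigma-algebras. -/

section Independence

variable {Ω : Type*} {mΩ : MeasurableSpace Ω} {μ : Measure Ω}

/-- If `a` is independent of `b`, and `a ⊔ b` of `c`, then `a` is independent of `b ⊔ c`. -/
theorem indep_sup_right_of_indep_sup_left [IsProbabilityMeasure μ] {a b c : MeasurableSpace Ω}
    (ha : a ≤ mΩ) (hb : b ≤ mΩ) (hc : c ≤ mΩ)
    (hab : Indep a b μ) (habc : Indep (a ⊔ b) c μ) : Indep a (b ⊔ c) μ := by
  have hbc : b ⊔ c = MeasurableSpace.generateFrom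
      {s | ∃ t u, MeasurableSet[b] t ∧ MeasurableSet[c] u ∧ t ∩ u = s} := by
    refine le_antisymm (sup_le (fun t ht ↦ ?_) fun u hu ↦ ?_) (MeasurableSpace.generateFrom_le ?_)
    · exact MeasurableSpace.measurableSet_generateFrom
        ⟨t, Set.univ, ht, MeasurableSet.univ, Set.inter_univ t⟩
    · exact MeasurableSpace.measurableSet_generateFrom
        ⟨Set.univ, u, MeasurableSet.univ, hu, Set.univ_inter u⟩
    · rintro _ ⟨t, u, ht, hu, rfl⟩
      exact MeasurableSet.inter ((le_sup_left : b ≤ b ⊔ c) t ht) ((le_sup_right : c ≤ b ⊔ c) u hu)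
  -- The intersections `t ∩ u` form a pi-system generating `b ⊔ c`, so the product formula is only
  -- needed there.
  refine IndepSets.indep ha (sup_le hb hc) (@MeasurableSpace.isPiSystem_measurableSet Ω a) ?_
    (@MeasurableSpace.generateFrom_measurableSet Ω a).symm hbc ?_
  · rintro _ ⟨t, u, ht, hu, rfl⟩ _ ⟨t', u', ht', hu', rfl⟩ -
    exact ⟨t ∩ t', u ∩ u', ht.inter ht', hu.inter hu', by
      rw [Set.inter_inter_inter_comm]⟩
  · rw [IndepSets_iff]
    rintro s _ hs ⟨t, u, ht, hu, rfl⟩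
    rw [Indep_iff] at hab habc
    have hst : MeasurableSet[a ⊔ b] (s ∩ t) :=
      MeasurableSet.inter ((le_sup_left : a ≤ a ⊔ b) s hs) ((le_sup_right : b ≤ a ⊔ b) t ht)
    rw [← Set.inter_assoc, habc _ _ hst hu, hab _ _ hs ht,
      habc t u ((le_sup_right : b ≤ a ⊔ b) t ht) hu, mul_assoc]

end Independence

/-! ### Calculus of cross moment matrices. -/

section Moments

variable {Ω : Type*} [MeasurableSpace Ω] {μ : Measure Ω} {a b c : ℕ}

/-- The cross moment matrix `𝔼[X Yᵀ]` of two random vectors. -/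
noncomputable def crossMoment (μ : Measure Ω) (X : Ω → Fin a → ℝ) (Y : Ω → Fin b → ℝ) :
    Matrix (Fin a) (Fin b) ℝ :=
  Matrix.of fun i j => ∫ ω, X ω i * Y ω j ∂μ

theorem crossMoment_self (X : Ω → Fin a → ℝ) : crossMoment μ X X = secondMoment μ X := rfl

theorem transpose_crossMoment (X : Ω → Fin a → ℝ) (Y : Ω → Fin b → ℝ) :
    (crossMoment μ X Y)ᵀ = crossMoment μ Y X := by
  ext i j
  simp [crossMoment, mul_comm]

theorem integrable_mul_eval {X : Ω → Fin a → ℝ} {Y : Ω → Fin b → ℝ} (hX : MemLp X 2 μ)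
    (hY : MemLp Y 2 μ) (i : Fin a) (j : Fin b) : Integrable (fun ω ↦ X ω i * Y ω j) μ :=
  MemLp.integrable_mul (hX.eval i) (hY.eval j)

theorem crossMoment_add_left {X X' : Ω → Fin a → ℝ} {Y : Ω → Fin b → ℝ} (hX : MemLp X 2 μ)
    (hX' : MemLp X' 2 μ) (hY : MemLp Y 2 μ) :
    crossMoment μ (X + X') Y = crossMoment μ X Y + crossMoment μ X' Y := by
  ext i j
  simp only [crossMoment, Matrix.of_apply, Matrix.add_apply, Pi.add_apply, add_mul]
  exact integral_add (integrable_mul_eval hX hY i j) (integrable_mul_eval hX' hY i j)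

theorem crossMoment_add_right {X : Ω → Fin a → ℝ} {Y Y' : Ω → Fin b → ℝ} (hX : MemLp X 2 μ)
    (hY : MemLp Y 2 μ) (hY' : MemLp Y' 2 μ) :
    crossMoment μ X (Y + Y') = crossMoment μ X Y + crossMoment μ X Y' := by
  rw [← transpose_crossMoment, crossMoment_add_left hY hY' hX, transpose_add,
    transpose_crossMoment, transpose_crossMoment]

theorem crossMoment_mulVec_left {X : Ω → Fin a → ℝ} {Y : Ω → Fin b → ℝ} (hX : MemLp X 2 μ)
    (hY : MemLp Y 2 μ) (M : Matrix (Fin c) (Fin a) ℝ) :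
    crossMoment μ (fun ω ↦ M *ᵥ X ω) Y = M * crossMoment μ X Y := by
  ext i j
  simp only [crossMoment, Matrix.of_apply, Matrix.mul_apply, mulVec, dotProduct, Finset.sum_mul,
    mul_assoc]
  rw [integral_finsetSum _ fun l _ ↦ (integrable_mul_eval hX hY l j).const_mul _]
  simp only [integral_const_mul]

theorem crossMoment_mulVec_right {X : Ω → Fin a → ℝ} {Y : Ω → Fin b → ℝ} (hX : MemLp X 2 μ)
    (hY : MemLp Y 2 μ) (M : Matrix (Fin c) (Fin b) ℝ) :
    crossMoment μ X (fun ω ↦ M *ᵥ Y ω) = crossMoment μ X Y * Mᵀ := by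
  rw [← transpose_crossMoment, crossMoment_mulVec_left hY hX, transpose_mul,
    transpose_crossMoment]

theorem integral_eval_eq_zero {X : Ω → Fin a → ℝ} (hX : Integrable X μ) (h0 : ∫ ω, X ω ∂μ = 0)
    (i : Fin a) : ∫ ω, X ω i ∂μ = 0 := by
  have := (ContinuousLinearMap.proj (R := ℝ) (φ := fun _ : Fin a ↦ ℝ) i).integral_comp_comm hX
  simpa [h0] using this

theorem crossMoment_eq_zero_of_indepFun {X : Ω → Fin a → ℝ} {Y : Ω → Fin b → ℝ}
    (hX : Integrable X μ) (hY : Integrable Y μ) (h0 : ∫ ω, X ω ∂μ = 0) (h : IndepFun X Y μ) :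
    crossMoment μ X Y = 0 := by
  ext i j
  have hij : IndepFun (fun ω ↦ X ω i) (fun ω ↦ Y ω j) μ :=
    h.comp (measurable_pi_apply i) (measurable_pi_apply j)
  simp only [crossMoment, Matrix.of_apply, Matrix.zero_apply]
  rw [hij.integral_fun_mul_eq_mul_integral (hX.eval i).aestronglyMeasurable
    (hY.eval j).aestronglyMeasurable, integral_eval_eq_zero hX h0, zero_mul]

end Moments

/-! ### One step of the error recursion. -/

section Step

variable {Ω : Type*} [MeasurableSpace Ω] {μ : Measure Ω} {n p : ℕ}

/-- The updated error and the innovation as a linear function of the current error, the disturbance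
and the measurement noise. -/
noncomputable def stepMap (A : Matrix (Fin n) (Fin n) ℝ) (C : Matrix (Fin p) (Fin n) ℝ)
    (K : Matrix (Fin n) (Fin p) ℝ) :
    ((Fin n → ℝ) × (Fin n → ℝ) × (Fin p → ℝ)) →L[ℝ] (Fin n → ℝ) × (Fin p → ℝ) :=
  LinearMap.toContinuousLinearMap
    { toFun := fun z ↦ ((A - K * C) *ᵥ z.1 + (z.2.1 + (-K) *ᵥ z.2.2), C *ᵥ z.1 + z.2.2)
      map_add' := fun z z' ↦ by
        ext i <;> simp [mulVec_add] <;> ring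
      map_smul' := fun r z ↦ by
        ext i <;> simp [mulVec_smul] }

/-- One step of the Kalman filter error recursion: the updated error is centered Gaussian, has the
Riccati covariance, and is independent of the innovation. -/
theorem error_step [IsProbabilityMeasure μ] {A P Q : Matrix (Fin n) (Fin n) ℝ}
    {C : Matrix (Fin p) (Fin n) ℝ} {R S : Matrix (Fin p) (Fin p) ℝ} {K : Matrix (Fin n) (Fin p) ℝ}
    {e w : Ω → Fin n → ℝ} {v : Ω → Fin p → ℝ}
    (he : HasGaussianLaw e μ) (hw : HasGaussianLaw w μ) (hv : HasGaussianLaw v μ)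
    (he0 : ∫ ω, e ω ∂μ = 0) (hw0 : ∫ ω, w ω ∂μ = 0) (hv0 : ∫ ω, v ω ∂μ = 0)
    (hwv : IndepFun w v μ) (hewv : IndepFun e (fun ω ↦ (w ω, v ω)) μ)
    (hP : secondMoment μ e = P) (hQ : secondMoment μ w = Q) (hR : secondMoment μ v = R)
    (hS : C * P * Cᵀ + R = S) (hSu : IsUnit S) (hK : A * P * Cᵀ * S⁻¹ = K) :
    let e' : Ω → Fin n → ℝ := fun ω ↦ (stepMap A C K (e ω, w ω, v ω)).1
    let i : Ω → Fin p → ℝ := fun ω ↦ (stepMap A C K (e ω, w ω, v ω)).2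
    HasGaussianLaw e' μ ∧ ∫ ω, e' ω ∂μ = 0 ∧ IndepFun e' i μ ∧
      secondMoment μ e' = A * P * Aᵀ + Q - A * P * Cᵀ * S⁻¹ * C * P * Aᵀ := by
  intro e' i
  -- The normal equation for the gain: it says exactly that new error and innovation are
  -- uncorrelated.
  have hKS : K * S = A * P * Cᵀ := by
    rw [← hK, Matrix.mul_assoc, Matrix.nonsing_inv_mul _ ((Matrix.isUnit_iff_isUnit_det S).1 hSu),
      Matrix.mul_one]
  have hjoint : HasGaussianLaw (fun ω ↦ (e' ω, i ω)) μ :=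
    (hewv.hasGaussianLaw he (hwv.hasGaussianLaw hw hv)).map_fun (stepMap A C K)
  have hew : IndepFun e w μ := hewv.comp measurable_id measurable_fst
  have hev : IndepFun e v μ := hewv.comp measurable_id measurable_snd
  have le := he.memLp_two
  have lw := hw.memLp_two
  have lv := hv.memLp_two
  have ie := he.integrable
  have iw := hw.integrable
  have iv := hv.integrable
  have cew := crossMoment_eq_zero_of_indepFun ie iw he0 hew
  have cwe := crossMoment_eq_zero_of_indepFun iw ie hw0 hew.symm
  have cev := crossMoment_eq_zero_of_indepFun ie iv he0 hev
  have cve := crossMoment_eq_zero_of_indepFun iv ie hv0 hev.symm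
  have cwv := crossMoment_eq_zero_of_indepFun iw iv hw0 hwv
  have cvw := crossMoment_eq_zero_of_indepFun iv iw hv0 hwv.symm
  have mulVec_memLp : ∀ {a b : ℕ} (M : Matrix (Fin a) (Fin b) ℝ) {X : Ω → Fin b → ℝ},
      HasGaussianLaw X μ → MemLp (fun ω ↦ M *ᵥ X ω) 2 μ := fun M _ hX ↦
    (hX.map_fun (LinearMap.toContinuousLinearMap M.mulVecLin)).memLp_two
  have lMe := mulVec_memLp (A - K * C) he
  have lKv := mulVec_memLp (-K) hv
  have lCe := mulVec_memLp C he
  have he'_eq : e' = (fun ω ↦ (A - K * C) *ᵥ e ω) + (w + fun ω ↦ (-K) *ᵥ v ω) := rfl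
  have hi_eq : i = (fun ω ↦ C *ᵥ e ω) + v := rfl
  have hcross : crossMoment μ e' i = 0 := by
    rw [he'_eq, hi_eq, crossMoment_add_left lMe (lw.add lKv) (lCe.add lv),
      crossMoment_add_left lw lKv (lCe.add lv), crossMoment_add_right lMe lCe lv,
      crossMoment_add_right lw lCe lv, crossMoment_add_right lKv lCe lv,
      crossMoment_mulVec_left le lCe, crossMoment_mulVec_left le lv,
      crossMoment_mulVec_left lv lCe, crossMoment_mulVec_left lv lv,
      crossMoment_mulVec_right le le, crossMoment_mulVec_right lw le,
      crossMoment_mulVec_right lv le, cev, cwe, cve, cwv, crossMoment_self, crossMoment_self,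
      hP, hR]
    have : (A - K * C) * (P * Cᵀ) + -K * R = A * P * Cᵀ - K * S := by
      rw [← hS]; simp only [Matrix.sub_mul, Matrix.mul_add, Matrix.mul_assoc, Matrix.neg_mul]; abel
    simp only [Matrix.mul_zero, Matrix.zero_mul, add_zero, zero_add, this, hKS, sub_self]
  have hmean : ∫ ω, e' ω ∂μ = 0 := by
    have h1 := (stepMap A C K).integral_comp_comm
      ((hewv.hasGaussianLaw he (hwv.hasGaussianLaw hw hv)).integrable)
    rw [integral_pair ie (iw.prodMk iv), integral_pair iw iv, he0, hw0, hv0] at h1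
    rw [← fst_integral hjoint.integrable]
    exact (congrArg Prod.fst h1).trans (congrArg Prod.fst (stepMap A C K).map_zero)
  refine ⟨hjoint.fst, hmean, ?_, ?_⟩
  -- Uncorrelated implies independent because the pair is jointly Gaussian; as `e'` is centered,
  -- covariances are cross moments.
  · refine HasGaussianLaw.indepFun_of_covariance_eval (X := fun j ω ↦ e' ω j)
      (Y := fun j ω ↦ i ω j) hjoint fun j l ↦ ?_
    rw [covariance_eq_sub (hjoint.fst.memLp_two.eval j) (hjoint.snd.memLp_two.eval l),
      integral_eval_eq_zero hjoint.fst.integrable hmean, zero_mul, sub_zero]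
    exact congrFun (congrFun hcross j) l
  · rw [← crossMoment_self, he'_eq, crossMoment_add_left lMe (lw.add lKv) (lMe.add (lw.add lKv)),
      crossMoment_add_left lw lKv (lMe.add (lw.add lKv)),
      crossMoment_add_right lMe lMe (lw.add lKv), crossMoment_add_right lw lMe (lw.add lKv),
      crossMoment_add_right lKv lMe (lw.add lKv), crossMoment_add_right lMe lw lKv,
      crossMoment_add_right lw lw lKv, crossMoment_add_right lKv lw lKv,
      crossMoment_mulVec_left le lMe, crossMoment_mulVec_left le lw,
      crossMoment_mulVec_left le lKv, crossMoment_mulVec_left lv lMe,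
      crossMoment_mulVec_left lv lw, crossMoment_mulVec_left lv lKv,
      crossMoment_mulVec_right le le, crossMoment_mulVec_right le lv,
      crossMoment_mulVec_right lw le, crossMoment_mulVec_right lw lv,
      crossMoment_mulVec_right lv le, crossMoment_mulVec_right lv lv, cew, cev, cwe, cve, cwv, cvw,
      crossMoment_self, crossMoment_self, crossMoment_self, hP, hQ, hR, hK]
    -- Substituting this into `K R Kᵀ` cancels the terms ending in `Cᵀ Kᵀ` of `(A - K C) P (A - K
    -- C)ᵀ`, which leaves the Riccati form.
    have hR' : K * R = A * P * Cᵀ - K * C * P * Cᵀ := by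
      rw [← hKS, ← hS]; simp only [Matrix.mul_add, Matrix.mul_assoc]; abel
    simp only [Matrix.mul_zero, Matrix.zero_mul, zero_add, transpose_sub, transpose_neg,
      transpose_mul, Matrix.neg_mul, Matrix.mul_neg, neg_neg, ← Matrix.mul_assoc, hR',
      Matrix.sub_mul, Matrix.mul_sub]
    abel

end Step

/-! ### Information carried by the initial state and earlier noises. -/

section Past

variable {Ω : Type*} {n p : ℕ} {x₀ : Ω → Fin n → ℝ} {w : ℕ → Ω → Fin n → ℝ}
  {v : ℕ → Ω → Fin p → ℝ}

/-- The indices of the initial state and of the noises at times before `k`. -/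
def pastIndex (k : ℕ) : Set (Option (ℕ ⊕ ℕ)) :=
  {i | ∀ j, i = some (Sum.inl j) ∨ i = some (Sum.inr j) → j < k}

/-- The sigma-algebra generated by the initial state and the noises at times before `k`. -/
@[reducible] def past (x₀ : Ω → Fin n → ℝ) (w : ℕ → Ω → Fin n → ℝ) (v : ℕ → Ω → Fin p → ℝ) (k : ℕ) :
    MeasurableSpace Ω :=
  ⨆ i ∈ pastIndex k, sourceSigma x₀ w v i

theorem past_mono : Monotone (past x₀ w v) := fun _ _ hkl ↦
  biSup_mono fun _ hi j hj ↦ (hi j hj).trans_le hkl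

theorem comap_initial_le_past (k : ℕ) : MeasurableSpace.comap x₀ inferInstance ≤ past x₀ w v k :=
  le_iSup₂_of_le (f := fun i (_ : i ∈ pastIndex k) ↦ sourceSigma x₀ w v i) none
    (by simp [pastIndex]) le_rfl

theorem comap_disturbance_le_past (k : ℕ) :
    MeasurableSpace.comap (w k) inferInstance ≤ past x₀ w v (k + 1) :=
  le_iSup₂_of_le (f := fun i (_ : i ∈ pastIndex (k + 1)) ↦ sourceSigma x₀ w v i)
    (some (Sum.inl k)) (by simp [pastIndex]) le_rfl

theorem comap_noise_le_past (k : ℕ) :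
    MeasurableSpace.comap (v k) inferInstance ≤ past x₀ w v (k + 1) :=
  le_iSup₂_of_le (f := fun i (_ : i ∈ pastIndex (k + 1)) ↦ sourceSigma x₀ w v i)
    (some (Sum.inr k)) (by simp [pastIndex]) le_rfl

variable [mΩ : MeasurableSpace Ω] {μ : Measure Ω}

theorem sourceSigma_le (hx₀ : Measurable x₀) (hw : ∀ k, Measurable (w k))
    (hv : ∀ k, Measurable (v k)) (i : Option (ℕ ⊕ ℕ)) : sourceSigma x₀ w v i ≤ mΩ := by
  rcases i with _ | k | k
  exacts [hx₀.comap_le, (hw k).comap_le, (hv k).comap_le]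

/-- The past stops strictly before `k`, so the two sides are generated by disjoint sets of
independent sources. -/
theorem indep_past (hx₀ : Measurable x₀) (hw : ∀ k, Measurable (w k))
    (hv : ∀ k, Measurable (v k)) (h : iIndep (sourceSigma x₀ w v) μ) (k : ℕ) :
    Indep (past x₀ w v k) (MeasurableSpace.comap (w k) inferInstance ⊔
      MeasurableSpace.comap (v k) inferInstance) μ := by
  have hd : Disjoint (pastIndex k) {some (Sum.inl k), some (Sum.inr k)} := by
    rw [Set.disjoint_left]
    rintro i hi (rfl | rfl)
    · exact lt_irrefl _ (hi k (Or.inl rfl))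
    · exact lt_irrefl _ (hi k (Or.inr rfl))
  have := indep_iSup_of_disjoint (sourceSigma_le hx₀ hw hv) h hd
  rwa [iSup_pair] at this

end Past

/-! ### Information carried by the measurements. -/

section History

variable {Ω : Type*} {p : ℕ} {y : ℕ → Ω → Fin p → ℝ}

theorem history_succ (k : ℕ) :
    history y (k + 1) = history y k ⊔ MeasurableSpace.comap (y k) inferInstance := by
  apply le_antisymm
  · refine iSup_le fun j ↦ ?_
    induction j using Fin.lastCases with
    | last => exact le_sup_right
    | cast j =>
      exact le_sup_of_le_left
        (le_iSup (fun j : Fin k ↦ MeasurableSpace.comap (y j) inferInstance) j)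
  · refine sup_le (iSup_le fun j ↦ ?_) ?_
    · exact le_iSup (fun j : Fin (k + 1) ↦ MeasurableSpace.comap (y j) inferInstance) j.castSucc
    · exact le_iSup (fun j : Fin (k + 1) ↦ MeasurableSpace.comap (y j) inferInstance) (Fin.last k)

theorem measurable_history (k : ℕ) :
    Measurable[history y k] fun ω (j : Fin k) ↦ y j ω :=
  @measurable_pi_lambda _ _ _ (history y k) _ _ fun j ↦ measurable_iff_comap_le.2
    (le_iSup (fun j : Fin k ↦ MeasurableSpace.comap (y j) inferInstance) j)

end History

/-! ### Conditional moments under independence. -/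

section Conditional

variable {Ω : Type*} {𝓖 : MeasurableSpace Ω} [mΩ : MeasurableSpace Ω] {μ : Measure Ω}
  [IsProbabilityMeasure μ] {d : ℕ}

theorem condExp_eq_zero_of_indep (h𝓖 : 𝓖 ≤ mΩ) {X : Ω → Fin d → ℝ}
    (hX : Measurable X) (h0 : ∫ ω, X ω ∂μ = 0)
    (h : Indep 𝓖 (MeasurableSpace.comap X inferInstance) μ) : μ[X | 𝓖] =ᵐ[μ] 0 := by
  have := condExp_indep_eq hX.comap_le h𝓖 (comap_measurable X).stronglyMeasurable h.symm
  rw [h0] at this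
  exact this

/-- The inner conditional mean vanishes, and the products `X i * X j` are functions of `X`, hence
independent of `𝓖`. -/
theorem condCov_eq_secondMoment_of_indep (h𝓖 : 𝓖 ≤ mΩ)
    {X : Ω → Fin d → ℝ} (hX : Measurable X) (h0 : ∫ ω, X ω ∂μ = 0)
    (h : Indep 𝓖 (MeasurableSpace.comap X inferInstance) μ) :
    ∀ᵐ ω ∂μ, condCov μ 𝓖 X ω = secondMoment μ X := by
  have hz := condExp_eq_zero_of_indep h𝓖 hX h0 h
  have hij : ∀ i j, ∀ᵐ ω ∂μ, condCov μ 𝓖 X ω i j = secondMoment μ X i j := fun i j ↦ by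
    have h1 : (fun ω ↦ (X ω i - (μ[X | 𝓖]) ω i) * (X ω j - (μ[X | 𝓖]) ω j))
        =ᵐ[μ] fun ω ↦ X ω i * X ω j := by
      filter_upwards [hz] with ω hω
      simp [hω]
    have h2 : Measurable[MeasurableSpace.comap X inferInstance] fun ω ↦ X ω i * X ω j :=
      ((measurable_pi_apply i).comp (comap_measurable X)).mul
        ((measurable_pi_apply j).comp (comap_measurable X))
    filter_upwards [condExp_congr_ae h1,
      condExp_indep_eq hX.comap_le h𝓖 h2.stronglyMeasurable h.symm] with ω h3 h4
    exact h3.trans h4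
  filter_upwards [ae_all_iff.2 fun i ↦ ae_all_iff.2 (hij i)] with ω hω
  ext i j
  exact hω i j

end Conditional

/-! ### The induction on time. -/

/-- The prediction error is centered Gaussian with covariance `P k`, and it is independent of the
measurements before time `k`, which determine the estimate. -/
theorem error_properties {Ω : Type*} [MeasurableSpace Ω] (μ : Measure Ω) [IsProbabilityMeasure μ]
    {n m p : ℕ} {A : ℕ → Matrix (Fin n) (Fin n) ℝ} {B : ℕ → Matrix (Fin n) (Fin m) ℝ}
    {C : ℕ → Matrix (Fin p) (Fin n) ℝ}
    {x w : ℕ → Ω → Fin n → ℝ} {u : ℕ → Ω → Fin m → ℝ} {y v : ℕ → Ω → Fin p → ℝ}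
    (hx : ∀ k ω, x (k + 1) ω = A k *ᵥ x k ω + B k *ᵥ u k ω + w k ω)
    (hy : ∀ k ω, y k ω = C k *ᵥ x k ω + v k ω)
    {π : (k : ℕ) → (Fin (k + 1) → Fin p → ℝ) → Fin m → ℝ} (hπ : ∀ k, Measurable (π k))
    (hu : ∀ k ω, u k ω = π k (fun j => y j ω))
    (hx₀_meas : Measurable (x 0)) (hw_meas : ∀ k, Measurable (w k))
    (hv_meas : ∀ k, Measurable (v k))
    (hx₀_gauss : HasGaussianLaw (x 0) μ)
    (hw_gauss : ∀ k, HasGaussianLaw (w k) μ) (hw_mean : ∀ k, ∫ ω, w k ω ∂μ = 0)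
    (hv_gauss : ∀ k, HasGaussianLaw (v k) μ) (hv_mean : ∀ k, ∫ ω, v k ω ∂μ = 0)
    (hindep : iIndep (sourceSigma (x 0) w v) μ)
    (hinv : ∀ k, IsUnit (innovationCov μ A C (x 0) w v k)) (k : ℕ) :
    let xhat := estimate μ A B C (x 0) w v u y k
    let e := fun ω ↦ x k ω - xhat ω
    Measurable[past (x 0) w v k] (x k) ∧ history y k ≤ past (x 0) w v k ∧
      Measurable[history y k] xhat ∧ HasGaussianLaw e μ ∧ ∫ ω, e ω ∂μ = 0 ∧
      Indep (history y k) (MeasurableSpace.comap e inferInstance) μ ∧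
      secondMoment μ e = errorCov μ A C (x 0) w v k := by
  have hpast : ∀ l, past (x 0) w v l ≤ ‹MeasurableSpace Ω› := fun l ↦
    iSup₂_le fun i _ ↦ sourceSigma_le hx₀_meas hw_meas hv_meas i
  induction k with
  | zero =>
    have hH : history y 0 = ⊥ := iSup_of_empty _
    refine ⟨measurable_iff_comap_le.2 (comap_initial_le_past 0), hH ▸ bot_le, measurable_const,
      ?_, ?_, hH ▸ indep_bot_left _, rfl⟩
    · have := hx₀_gauss.isGaussian_map
      refine ⟨?_⟩
      have h := Measure.map_map (μ := μ) (f := x 0) (g := fun z ↦ z - ∫ ω, x 0 ω ∂μ)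
        (by fun_prop) hx₀_meas
      change IsGaussian (μ.map ((fun z ↦ z - ∫ ω, x 0 ω ∂μ) ∘ x 0))
      rw [← h]
      infer_instance
    · change ∫ ω, (x 0 ω - ∫ ω', x 0 ω' ∂μ) ∂μ = 0
      rw [integral_sub hx₀_gauss.integrable (integrable_const _)]
      simp
  | succ k ih =>
    obtain ⟨hxm, hHle, hxhm, heg, he0, heH, heP⟩ := ih
    intro xhat' e'
    set xhat := estimate μ A B C (x 0) w v u y k
    set e := fun ω ↦ x k ω - xhat ω
    have hle : past (x 0) w v k ≤ past (x 0) w v (k + 1) := past_mono k.le_succ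
    have hwp : Measurable[past (x 0) w v (k + 1)] (w k) :=
      measurable_iff_comap_le.2 (comap_disturbance_le_past k)
    have hvp : Measurable[past (x 0) w v (k + 1)] (v k) :=
      measurable_iff_comap_le.2 (comap_noise_le_past k)
    have hym : Measurable[past (x 0) w v (k + 1)] (y k) := by
      rw [funext (hy k)]
      exact Measurable.add (((by fun_prop : Measurable fun z : Fin n → ℝ ↦ C k *ᵥ z)).comp
        (hxm.mono hle le_rfl)) hvp
    have hH' : history y (k + 1) ≤ past (x 0) w v (k + 1) := by
      rw [history_succ]
      exact sup_le (hHle.trans hle) (measurable_iff_comap_le.1 hym)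
    have hum : Measurable[history y (k + 1)] (u k) := by
      rw [funext (hu k)]
      exact (hπ k).comp (measurable_history (k + 1))
    have hxm' : Measurable[past (x 0) w v (k + 1)] (x (k + 1)) := by
      rw [funext (hx k)]
      exact Measurable.add (Measurable.add
        ((by fun_prop : Measurable fun z : Fin n → ℝ ↦ A k *ᵥ z).comp (hxm.mono hle le_rfl))
        ((by fun_prop : Measurable fun z : Fin m → ℝ ↦ B k *ᵥ z).comp (hum.mono hH' le_rfl))) hwp
    have hxh1 : Measurable[history y (k + 1)] xhat :=
      hxhm.mono (by rw [history_succ]; exact le_sup_left) le_rfl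
    have hyH : Measurable[history y (k + 1)] (y k) :=
      measurable_iff_comap_le.2 (by rw [history_succ]; exact le_sup_right)
    have hxhm' : Measurable[history y (k + 1)] xhat' := by
      refine Measurable.add (Measurable.add
        ((by fun_prop : Measurable fun z : Fin n → ℝ ↦ A k *ᵥ z).comp hxh1)
        ((by fun_prop : Measurable fun z : Fin m → ℝ ↦ B k *ᵥ z).comp hum))
        ((by fun_prop : Measurable fun z : Fin p → ℝ ↦ gain μ A C (x 0) w v k *ᵥ z).comp
          (Measurable.sub hyH
            ((by fun_prop : Measurable fun z : Fin n → ℝ ↦ C k *ᵥ z).comp hxh1)))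
    have hem : Measurable[past (x 0) w v k] e := Measurable.sub hxm (hxhm.mono hHle le_rfl)
    set K := gain μ A C (x 0) w v k
    set F := fun ω ↦ stepMap (A k) (C k) K (e ω, w k ω, v k ω)
    -- The input term `B k *ᵥ u k` occurs in both state and estimate, and cancels.
    have he' : e' = fun ω ↦ (F ω).1 := by
      funext ω
      change x (k + 1) ω - (A k *ᵥ xhat ω + B k *ᵥ u k ω + K *ᵥ (y k ω - C k *ᵥ xhat ω)) =
        (A k - K * C k) *ᵥ (x k ω - xhat ω) + (w k ω + (-K) *ᵥ v k ω)
      rw [hx, hy]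
      simp only [mulVec_sub, mulVec_add, sub_mulVec, neg_mulVec, ← mulVec_mulVec]
      abel
    have hi : (fun ω ↦ y k ω - C k *ᵥ xhat ω) = fun ω ↦ (F ω).2 := by
      funext ω
      change y k ω - C k *ᵥ xhat ω = C k *ᵥ (x k ω - xhat ω) + v k ω
      rw [hy, mulVec_sub]
      abel
    have hwv : IndepFun (w k) (v k) μ :=
      (IndepFun_iff_Indep _ _ _).2 (hindep.indep (i := some (Sum.inl k)) (j := some (Sum.inr k))
        (by simp))
    have hpk := indep_past hx₀_meas hw_meas hv_meas hindep k
    have hprod : MeasurableSpace.comap (fun ω ↦ (w k ω, v k ω)) inferInstance =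
        MeasurableSpace.comap (w k) inferInstance ⊔ MeasurableSpace.comap (v k) inferInstance :=
      MeasurableSpace.comap_prodMk _ _
    have hewv : IndepFun e (fun ω ↦ (w k ω, v k ω)) μ := by
      rw [IndepFun_iff_Indep, hprod]
      exact indep_of_indep_of_le_left hpk (measurable_iff_comap_le.1 hem)
    obtain ⟨h1, h2, h3, h4⟩ := error_step (K := K) heg (hw_gauss k) (hv_gauss k) he0 (hw_mean k)
      (hv_mean k) hwv hewv heP rfl rfl rfl (hinv k) rfl
    have hHe : Indep (history y k) (MeasurableSpace.comap e inferInstance ⊔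
        (MeasurableSpace.comap (w k) inferInstance ⊔ MeasurableSpace.comap (v k) inferInstance)) μ :=
      indep_sup_right_of_indep_sup_left (hHle.trans (hpast k))
        ((measurable_iff_comap_le.1 hem).trans (hpast k))
        (sup_le (hw_meas k).comap_le (hv_meas k).comap_le) heH
        (indep_of_indep_of_le_left hpk (sup_le hHle (measurable_iff_comap_le.1 hem)))
    rw [← hprod, ← MeasurableSpace.comap_prodMk] at hHe
    have hFle : MeasurableSpace.comap F inferInstance ≤
        MeasurableSpace.comap (fun ω ↦ (e ω, w k ω, v k ω)) inferInstance :=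
      ((stepMap (A k) (C k) K).continuous.measurable.comp (comap_measurable _)).comap_le
    have hFm : Measurable F := (stepMap (A k) (C k) K).continuous.measurable.comp
      ((hem.mono (hpast k) le_rfl).prodMk ((hw_meas k).prodMk (hv_meas k)))
    have hHF : Indep (history y k) (MeasurableSpace.comap (fun ω ↦ (F ω).1) inferInstance ⊔
        MeasurableSpace.comap (fun ω ↦ (F ω).2) inferInstance) μ := by
      rw [← MeasurableSpace.comap_prodMk]
      exact indep_of_indep_of_le_right hHe hFle
    -- Independence of `e'` from the innovation, and of the pair from the old history, is regrouped
    -- so that `e'` stands alone.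
    have hind : Indep (MeasurableSpace.comap (fun ω ↦ (F ω).1) inferInstance)
        (MeasurableSpace.comap (fun ω ↦ (F ω).2) inferInstance ⊔ history y k) μ :=
      indep_sup_right_of_indep_sup_left hFm.fst.comap_le hFm.snd.comap_le
        (hHle.trans (hpast k)) ((IndepFun_iff_Indep _ _ _).1 h3) hHF.symm
    have hyle : history y (k + 1) ≤
        MeasurableSpace.comap (fun ω ↦ (F ω).2) inferInstance ⊔ history y k := by
      rw [history_succ]
      refine sup_le le_sup_right (measurable_iff_comap_le.1 ?_)
      -- The measurement is the innovation plus a prediction already determined by the old history.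
      have hy' : y k = fun ω ↦ (F ω).2 + C k *ᵥ xhat ω := by
        funext ω
        rw [← congrFun hi ω, sub_add_cancel]
      rw [hy']
      exact Measurable.add ((comap_measurable fun ω ↦ (F ω).2).mono le_sup_left le_rfl)
        ((by fun_prop : Measurable fun z : Fin n → ℝ ↦ C k *ᵥ z).comp
          (hxhm.mono le_sup_right le_rfl))
    rw [he']
    exact ⟨hxm', hH', hxhm', h1, h2, (indep_of_indep_of_le_right hind hyle).symm, h4⟩

end KalmanFilter
-- Conditioning on the history and on the estimate.
/-- The Kalman one-step prediction error has, given the current estimate alone, conditional mean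
zero and conditional covariance `P k`. -/
theorem mainTheorem3 {Ω : Type*} [MeasurableSpace Ω] (μ : Measure Ω) [IsProbabilityMeasure μ]
    (n m p : ℕ)
    (A : ℕ → Matrix (Fin n) (Fin n) ℝ) (B : ℕ → Matrix (Fin n) (Fin m) ℝ)
    (C : ℕ → Matrix (Fin p) (Fin n) ℝ)
    (x w : ℕ → Ω → Fin n → ℝ) (u : ℕ → Ω → Fin m → ℝ) (y v : ℕ → Ω → Fin p → ℝ)
    -- the linear system
    (hx : ∀ k ω, x (k + 1) ω = A k *ᵥ x k ω + B k *ᵥ u k ω + w k ω)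
    (hy : ∀ k ω, y k ω = C k *ᵥ x k ω + v k ω)
    -- causal output feedback (open-loop inputs are the constant policies)
    (π : (k : ℕ) → (Fin (k + 1) → Fin p → ℝ) → Fin m → ℝ) (hπ : ∀ k, Measurable (π k))
    (hu : ∀ k ω, u k ω = π k (fun j => y j ω))
    -- Gaussian initial state and zero-mean Gaussian noises, all mutually independent
    (hx₀_meas : Measurable (x 0)) (hw_meas : ∀ k, Measurable (w k))
    (hv_meas : ∀ k, Measurable (v k))
    (hx₀_gauss : HasGaussianLaw (x 0) μ)
    (hw_gauss : ∀ k, HasGaussianLaw (w k) μ) (hw_mean : ∀ k, ∫ ω, w k ω ∂μ = 0)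
    (hv_gauss : ∀ k, HasGaussianLaw (v k) μ) (hv_mean : ∀ k, ∫ ω, v k ω ∂μ = 0)
    (hindep : iIndep (KalmanFilter.sourceSigma (x 0) w v) μ)
    -- the inverses in the filter exist
    (hinv : ∀ k, IsUnit (KalmanFilter.innovationCov μ A C (x 0) w v k))
    -- the filter estimates and the Riccati covariances
    (xhat : ℕ → Ω → Fin n → ℝ) (hxhat : xhat = KalmanFilter.estimate μ A B C (x 0) w v u y)
    (P : ℕ → Matrix (Fin n) (Fin n) ℝ) (hP : P = KalmanFilter.errorCov μ A C (x 0) w v) :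
    ∀ k : ℕ,
      (Integrable (x k) μ → xhat k =ᵐ[μ] μ[x k | KalmanFilter.history y k]) ∧
      MemLp (fun ω => x k ω - xhat k ω) 2 μ ∧
      μ[fun ω => x k ω - xhat k ω | MeasurableSpace.comap (xhat k) inferInstance] =ᵐ[μ] 0 ∧
      ∀ᵐ ω ∂μ,
        KalmanFilter.condCov μ (MeasurableSpace.comap (xhat k) inferInstance)
          (fun ω' => x k ω' - xhat k ω') ω = P k := by
  intro k
  obtain ⟨hxm, hHle, hxhm, heg, he0, heH, heP⟩ := KalmanFilter.error_properties μ (B := B) hx hy hπ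
    hu hx₀_meas hw_meas hv_meas hx₀_gauss hw_gauss hw_mean hv_gauss hv_mean hindep hinv k
  subst hxhat hP
  have hpast : KalmanFilter.past (x 0) w v k ≤ ‹MeasurableSpace Ω› :=
    iSup₂_le fun i _ ↦ KalmanFilter.sourceSigma_le hx₀_meas hw_meas hv_meas i
  have hH := hHle.trans hpast
  have hxhm' := hxhm.mono hH le_rfl
  have hem := (hxm.mono hpast le_rfl).sub hxhm'
  have hind := indep_of_indep_of_le_left heH hxhm.comap_le
  refine ⟨fun hxi ↦ ?_, heg.memLp_two,
    KalmanFilter.condExp_eq_zero_of_indep hxhm'.comap_le hem he0 hind, ?_⟩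
  · have hz := KalmanFilter.condExp_eq_zero_of_indep hH hem he0 heH
    -- The error is always integrable, so integrability of the state passes to the estimate.
    have hxhi : Integrable (KalmanFilter.estimate μ A B C (x 0) w v u y k) μ :=
      (hxi.sub heg.integrable).congr (.of_forall fun ω ↦ sub_sub_cancel _ _)
    have hsub := condExp_sub hxi hxhi (KalmanFilter.history y k)
    rw [condExp_of_stronglyMeasurable hH hxhm.stronglyMeasurable hxhi] at hsub
    filter_upwards [hz, hsub] with ω h1 h2
    exact (sub_eq_zero.1 (h2.symm.trans h1)).symm
  · rw [← heP]
    exact KalmanFilter.condCov_eq_secondMoment_of_indep hxhm'.comap_le hem he0 hind
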